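/- A directed forest $\mathcal T=(V,\mathsf p)$ is a nonempty set $V$ with a map $\mathsf p\colon V\to V$ such that $\mathsf p^n(v)=v$ with $n\ge 1$ implies $\mathsf p(v)=v$. A root is a vertex $v$ with $\mathsf p(v)=v$, and the children of $v$ are the vertices $u\ne v$ with $\mathsf p(u)=v$. The forest is leafless if $\mathsf p(V)=V$, and forkless if every vertex that is not a root has exactly one child. A directed forest $(V,\mathsf q)$ is thinner than $(V,\mathsf p)$ if $\mathsf q(v)\in\{v,\mathsf p(v)\}$ for all $v\in V$; in that case $(V,\mathsf p)$ is thicker than $(V,\mathsf q)$. The leafless support of $\mathcal T$ is the thickest leafless directed forest thinner than $\mathcal T$ (it exists and is unique). A bounded weighted shift on $\mathcal T$ is a bounded linear operator $S$ on the complex Hilbert space $\ell^2(V)$ of the form $(Sf)(v)=\lambda_v f(\mathsf p(v))$ for all $f\in\ell^2(V)$, $v\in V$, where $\lambda_v\in\mathbb C$ and $\lambda_v=0$ for every root $v$. A bounded operator $S$ on a complex Hilbert space is hyponormal if $S^*S-SS^*\ge 0$, and power hyponormal if $S^n$ is hyponormal for every integer $n\ge 1$. **Theorem.** Let $\mathcal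 T=(V,\mathsf p)$ be an arbitrary directed forest. The following conditions are equivalent: (a) every bounded hyponormal weighted shift on $\mathcal T$ is power hyponormal; (b) the square of every bounded hyponormal weighted shift on $\mathcal T$ is hyponormal; (c) the leafless support of $\mathcal T$ is forkless; (d) every leafless directed forest thinner than $\mathcal T$ is forkless. -/

import Mathlib

/-- A directed forest with vertex set `V`: a parent function `V → V` without proper cycles.
A root is a vertex which is its own parent. -/
@[ext]
structure DirectedForest (V : Type*) where
  /-- the parent function -/
  parent : V → V
  acyclic : ∀ (n : ℕ) (v : V), 1 ≤ n → parent^[n] v = v → parent v = v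

namespace DirectedForest

variable {V : Type*}

/-- `v` is a root. -/
def IsRoot (T : DirectedForest V) (v : V) : Prop := T.parent v = v

/-- The set of children of `v` (a root is not a child of itself). -/
def children (T : DirectedForest V) (v : V) : Set V := {u | T.parent u = v ∧ v ≠ u}

/-- The degree of a vertex: the cardinality of the set of its children. -/
noncomputable def degree (T : DirectedForest V) (v : V) : Cardinal := Cardinal.mk (T.children v)

/-- No leaves: every vertex is in the range of the parent function. -/
def Leafless (T : DirectedForest V) : Prop := Function.Surjective T.parent

/-- Every vertex that is not a root has exactly one child. -/
def Forkless (T : DirectedForest V) : Prop := ∀ v, ¬ T.IsRoot v → T.degree v = 1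

/-- `T₁.Thinner T₂`: the forest `T₁` is thinner than `T₂` (not necessarily strictly). -/
def Thinner (T₁ T₂ : DirectedForest V) : Prop :=
  ∀ v, T₁.parent v = v ∨ T₁.parent v = T₂.parent v

/-- `S` is the thickest leafless directed forest thinner than `T`. -/
def IsLeaflessSupport (T S : DirectedForest V) : Prop :=
  (S.Leafless ∧ S.Thinner T) ∧
    ∀ R : DirectedForest V, R.Leafless → R.Thinner T → R.Thinner S

/-- A function thinner than the parent function of a directed forest is itself the parent
function of a directed forest. -/
theorem acyclic_of_thinner (T : DirectedForest V) (q : V → V)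
    (hq : ∀ v, q v = v ∨ q v = T.parent v) (n : ℕ) (v : V) (hn : 1 ≤ n)
    (h : q^[n] v = v) : q v = v := by
  have key : ∀ k : ℕ, q^[k] v = T.parent^[k] v ∨ q (q^[k] v) = q^[k] v := by
    intro k
    induction k with
    | zero => left; rfl
    | succ k ih =>
      rw [Function.iterate_succ_apply', Function.iterate_succ_apply']
      rcases ih with ih | ih
      · rcases hq (q^[k] v) with h1 | h1
        · right; rw [h1, h1]
        · left; rw [h1, ih]
      · right; rw [ih, ih]
  rcases key n with h1 | h1
  · have h2 := T.acyclic n v hn (h1.symm.trans h)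
    rcases hq v with h3 | h3
    · exact h3
    · rw [h3, h2]
  · rwa [h] at h1

theorem existsUnique_isLeaflessSupport (T : DirectedForest V) :
    ∃! S : DirectedForest V, T.IsLeaflessSupport S := by
  classical
  let q : V → V := fun v =>
    if ∃ R : DirectedForest V, R.Leafless ∧ R.Thinner T ∧ R.parent v ≠ v then T.parent v else v
  have hq : ∀ v, q v = v ∨ q v = T.parent v := by
    intro v
    by_cases h : ∃ R : DirectedForest V, R.Leafless ∧ R.Thinner T ∧ R.parent v ≠ v
    · right; simp only [q, if_pos h]
    · left; simp only [q, if_neg h]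
  have hqR : ∀ R : DirectedForest V, R.Leafless → R.Thinner T → ∀ v, R.parent v ≠ v →
      q v = R.parent v := by
    intro R h1 h2 v h3
    have h : ∃ R : DirectedForest V, R.Leafless ∧ R.Thinner T ∧ R.parent v ≠ v :=
      ⟨R, h1, h2, h3⟩
    simp only [q, if_pos h]
    exact ((h2 v).resolve_left h3).symm
  have hl : Function.Surjective q := by
    intro v
    by_cases h : ∃ R : DirectedForest V, R.Leafless ∧ R.Thinner T ∧ R.parent v ≠ v
    · obtain ⟨R, h1, h2, h3⟩ := h
      obtain ⟨u, hu⟩ := h1 v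
      have hne : R.parent u ≠ u := by
        intro hu'
        have huv : u = v := hu'.symm.trans hu
        rw [huv] at hu
        exact h3 hu
      exact ⟨u, (hqR R h1 h2 u hne).trans hu⟩
    · exact ⟨v, by simp only [q, if_neg h]⟩
  refine ⟨⟨q, T.acyclic_of_thinner q hq⟩, ⟨⟨hl, hq⟩, ?_⟩, ?_⟩
  · intro R h1 h2 v
    by_cases h : R.parent v = v
    · exact Or.inl h
    · exact Or.inr (hqR R h1 h2 v h).symm
  · intro S hS
    ext v
    by_cases h : S.parent v = v
    · rcases hS.2 ⟨q, T.acyclic_of_thinner q hq⟩ hl hq v with h1 | h1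
      · exact h.trans h1.symm
      · exact h1.symm
    · exact (hqR S hS.1.1 hS.1.2 v h).symm

/-- The leafless support of `T`: the thickest leafless directed forest thinner than `T`. -/
noncomputable def leaflessSupport (T : DirectedForest V) : DirectedForest V :=
  Classical.choose T.existsUnique_isLeaflessSupport.exists

theorem isLeaflessSupport_leaflessSupport (T : DirectedForest V) :
    T.IsLeaflessSupport T.leaflessSupport :=
  Classical.choose_spec T.existsUnique_isLeaflessSupport.exists

/-- A system of weights on `T`: complex numbers indexed by the vertices, zero at the roots. -/
def IsWeightSystem (T : DirectedForest V) (w : V → ℂ) : Prop := ∀ v, T.IsRoot v → w v = 0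

/-- The formal weighted shift on all functions: `(Γ f)(v) = w v * f (parent v)`. -/
def gamma (T : DirectedForest V) (w : V → ℂ) (f : V → ℂ) : V → ℂ :=
  fun v => w v * f (T.parent v)

/-- The bounded operator `S` on `ℓ²(V)` is a weighted shift on `T`: for some system of weights
`w`, `S f = Γ f` for all `f` in `ℓ²(V)`. (So the natural domain `{f | Γ f ∈ ℓ²(V)}` of the
weighted shift with weights `w` is all of `ℓ²(V)`.) -/
def IsBoundedWeightedShift (T : DirectedForest V)
    (S : lp (fun _ : V => ℂ) 2 →L[ℂ] lp (fun _ : V => ℂ) 2) : Prop :=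
  ∃ w : V → ℂ, T.IsWeightSystem w ∧
    ∀ f : lp (fun _ : V => ℂ) 2, (S f : V → ℂ) = T.gamma w (f : V → ℂ)

end DirectedForest

/-- A bounded operator `S` on a complex Hilbert space is hyponormal if `S* S - S S* ≥ 0`. -/
def IsHyponormal {H : Type*} [NormedAddCommGroup H] [InnerProductSpace ℂ H] [CompleteSpace H]
    (S : H →L[ℂ] H) : Prop :=
  (ContinuousLinearMap.adjoint S * S - S * ContinuousLinearMap.adjoint S).IsPositive

/-- A bounded operator is power hyponormal if all its positive powers are hyponormal. -/
def IsPowerHyponormal {H : Type*} [NormedAddCommGroup H] [InnerProductSpace ℂ H]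
    [CompleteSpace H] (S : H →L[ℂ] H) : Prop :=
  ∀ n : ℕ, 1 ≤ n → IsHyponormal (S ^ n)

/-!
The operators are studied through the weighted composition operators `S f = w · (f ∘ φ)` on
`ℓ²(V)`, of which the powers of a weighted shift are instances (`φ` being an iterate of the parent
function). For such an operator `S* S` is diagonal with entries `‖S e_v‖²`, the sums of `‖w x‖²`
over the fibres of `φ`, while `S S*` is a direct sum of operators of rank at most one on the spaces
of functions supported on the fibres. Hence `S` is hyponormal if and only if the sum of
`‖w v‖² / ‖S e_v‖²` over every fibre is at most `1`
(`IsWeightedComposition.isHyponormal` and `IsWeightedComposition.fiberSum_div_le_one`).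

In particular a vertex of nonzero weight of a hyponormal weighted shift has a child of nonzero
weight, so making all vertices of zero weight into roots yields a leafless forest thinner than the
given one. If it is forkless, then the nonzero weights form lines, disjoint apart from a possible
common root, along which the moduli of the weights do not decrease. The summands of the criterion for
`S ^ (n + 1)` are then dominated by those for `S ^ n`
(`fiberSum_iterate_div_le_one`), and all powers are hyponormal.

Conversely, a leafless forest which is not forkless contains a vertex which is not a root, together
with two infinite lines of descendants starting at distinct children of it. A shift with weights
`8` at that vertex and `3, 5, 5, …` and `8, 10, 10, …` along the lines is hyponormal, but its square
is not (`DirectedForest.exists_isHyponormal_not_isHyponormal_sq`).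

The two conditions on forests agree because a leafless forest thinner than a leafless forkless
forest is forkless.
-/

open scoped ENNReal

/-! ### Sums over the fibres of a map -/

open Classical in
/-- The sum of `F` over the fibre of `φ` above `u`. -/
noncomputable def fiberSum {V : Type*} (φ : V → V) (F : V → ℝ≥0∞) (u : V) : ℝ≥0∞ :=
  ∑' v, if φ v = u then F v else 0

section FiberSum

variable {V : Type*} {φ : V → V} {F G : V → ℝ≥0∞}

theorem tsum_mul_comp_eq_tsum_fiberSum_mul (φ : V → V) (F G : V → ℝ≥0∞) :
    ∑' v, F v * G (φ v) = ∑' u, fiberSum φ F u * G u := by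
  classical
  simp only [fiberSum, ← ENNReal.tsum_mul_right]
  rw [ENNReal.tsum_comm]
  refine tsum_congr fun v => ?_
  rw [tsum_eq_single (φ v)]
  · simp
  · intro u hu
    simp [hu.symm]

theorem le_fiberSum (φ : V → V) (F : V → ℝ≥0∞) (v : V) : F v ≤ fiberSum φ F (φ v) := by
  classical
  refine le_trans ?_ (ENNReal.le_tsum v)
  simp

theorem fiberSum_eq_sum {u : V} (s : Finset V) (hs : ∀ v ∈ s, φ v = u)
    (h : ∀ v, φ v = u → v ∉ s → F v = 0) : fiberSum φ F u = ∑ v ∈ s, F v := by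
  classical
  rw [fiberSum, tsum_eq_sum (s := s)]
  · exact Finset.sum_congr rfl fun v hv => by simp [hs v hv]
  · intro v hv
    by_cases hvu : φ v = u
    · simp [hvu, h v hvu hv]
    · simp [hvu]

theorem fiberSum_eq_single {u v : V} (hv : φ v = u) (h : ∀ x, φ x = u → x ≠ v → F x = 0) :
    fiberSum φ F u = F v := by
  simpa using fiberSum_eq_sum (φ := φ) (F := F) {v} (by simpa using hv)
    (by simpa using h)

theorem fiberSum_eq_zero {u : V} (h : ∀ x, φ x = u → F x = 0) : fiberSum φ F u = 0 := by
  simpa using fiberSum_eq_sum (φ := φ) (F := F) (u := u) ∅ (by simp) (by simpa using h)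

theorem exists_ne_zero_of_fiberSum_ne_zero {u : V} (h : fiberSum φ F u ≠ 0) :
    ∃ v, φ v = u ∧ F v ≠ 0 := by
  by_contra! hne
  exact h (fiberSum_eq_zero hne)

/-- Comparison of fibre sums along a map `σ` which need only be injective on the support of the
smaller function. -/
theorem fiberSum_le_fiberSum_of_injOn {ψ : V → V} (σ : V → V) (u : V)
    (hσ : Set.InjOn σ {v | φ v = u ∧ F v ≠ 0})
    (hmaps : ∀ v, φ v = u → F v ≠ 0 → ψ (σ v) = u)
    (hle : ∀ v, φ v = u → F v ≠ 0 → F v ≤ G (σ v)) :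
    fiberSum φ F u ≤ fiberSum ψ G u := by
  classical
  set s : Set V := {v | φ v = u ∧ F v ≠ 0} with hs
  have h1 : fiberSum φ F u = ∑' v : s, F v := by
    rw [fiberSum, tsum_subtype s F]
    refine tsum_congr fun v => ?_
    by_cases h : φ v = u <;> by_cases h' : F v = 0 <;> simp [hs, Set.indicator, h, h']
  have h2 : ∀ v : s, F v ≤ (fun x => if ψ x = u then G x else 0) (σ v) := by
    rintro ⟨v, hv⟩
    simpa [hmaps v hv.1 hv.2] using hle v hv.1 hv.2
  rw [h1]
  refine (ENNReal.tsum_le_tsum h2).trans ?_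
  exact ENNReal.tsum_comp_le_tsum_of_injective (f := fun v : s => σ v)
    (fun x y hxy => Subtype.ext (hσ x.2 y.2 hxy)) _

end FiberSum

/-! ### The norm of `ℓ²` in extended nonnegative reals -/

section L2

variable {V : Type*}

theorem enorm_sq_eq_tsum_enorm_sq (f : lp (fun _ : V => ℂ) 2) :
    ‖f‖ₑ ^ 2 = ∑' v, ‖f v‖ₑ ^ 2 := by
  have h := lp.hasSum_norm (p := 2) (by norm_num) f
  simp only [ENNReal.toReal_ofNat, Real.rpow_ofNat] at h
  have h' : HasSum (fun v => ‖f v‖₊ ^ 2) (‖f‖₊ ^ 2) := by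
    rw [← NNReal.hasSum_coe]
    simpa using h
  simpa [enorm] using (ENNReal.tsum_coe_eq h').symm

theorem memℓp_two_of_tsum_enorm_sq_ne_top {f : V → ℂ} (h : ∑' v, ‖f v‖ₑ ^ 2 ≠ ∞) :
    Memℓp f 2 := by
  refine memℓp_gen ?_
  have h' : Summable fun v => ‖f v‖₊ ^ 2 := by
    rw [← ENNReal.tsum_coe_ne_top_iff_summable]
    simpa [enorm] using h
  simpa using (NNReal.summable_coe.2 h')

end L2

/-! ### Hyponormality and weighted composition operators -/

section Hyponormal

open ContinuousLinearMap

theorem isHyponormal_iff_norm_adjoint_apply_le {H : Type*} [NormedAddCommGroup H]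
    [InnerProductSpace ℂ H] [CompleteSpace H] (S : H →L[ℂ] H) :
    IsHyponormal S ↔ ∀ x, ‖adjoint S x‖ ≤ ‖S x‖ := by
  have key : ∀ x, (adjoint S * S - S * adjoint S).reApplyInnerSelf x
      = ‖S x‖ ^ 2 - ‖adjoint S x‖ ^ 2 := by
    intro x
    have h1 : inner ℂ ((adjoint S * S) x) x = inner ℂ (S x) (S x) := by
      simp [adjoint_inner_left]
    have h2 : inner ℂ ((S * adjoint S) x) x = inner ℂ (adjoint S x) (adjoint S x) :=
      (adjoint_inner_right S _ _).symm
    rw [reApplyInnerSelf_apply, sub_apply, inner_sub_left, h1, h2, map_sub,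
      inner_self_eq_norm_sq, inner_self_eq_norm_sq]
  have hsymm : (adjoint S * S - S * adjoint S).IsSymmetric := by
    rw [← isSelfAdjoint_iff_isSymmetric, ← star_eq_adjoint]
    exact (IsSelfAdjoint.star_mul_self S).sub (IsSelfAdjoint.mul_star_self S)
  rw [IsHyponormal, isPositive_def]
  constructor
  · rintro ⟨-, h⟩ x
    have hx := h x
    rw [key, sub_nonneg] at hx
    exact le_of_sq_le_sq hx (norm_nonneg _)
  · intro h
    refine ⟨hsymm, fun x => ?_⟩
    rw [key, sub_nonneg]
    gcongr
    exact h x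

variable {V : Type*}

/-- `S` is the weighted composition operator `f ↦ w · (f ∘ φ)` on `ℓ²(V)`. Powers of a weighted
shift on a directed forest are of this form, with `φ` an iterate of the parent function. -/
def IsWeightedComposition (φ : V → V) (w : V → ℂ)
    (S : lp (fun _ : V => ℂ) 2 →L[ℂ] lp (fun _ : V => ℂ) 2) : Prop :=
  ∀ f v, S f v = w v * f (φ v)

variable {φ : V → V} {w : V → ℂ} {S : lp (fun _ : V => ℂ) 2 →L[ℂ] lp (fun _ : V => ℂ) 2}

theorem IsWeightedComposition.mul {ψ : V → V} {w' : V → ℂ}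
    {S' : lp (fun _ : V => ℂ) 2 →L[ℂ] lp (fun _ : V => ℂ) 2}
    (h : IsWeightedComposition φ w S) (h' : IsWeightedComposition ψ w' S') :
    IsWeightedComposition (ψ ∘ φ) (fun v => w v * w' (φ v)) (S * S') := by
  intro f v
  rw [mul_apply_eq_comp, h, h', mul_assoc, Function.comp_apply]

/-- The squared moduli of the weights determine the norms `‖S f‖`: the operator `S* S` is
diagonal, with the sums over the fibres of `φ` as diagonal entries. -/
theorem IsWeightedComposition.enorm_apply_sq (h : IsWeightedComposition φ w S)
    (f : lp (fun _ : V => ℂ) 2) :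
    ‖S f‖ₑ ^ 2 = ∑' u, fiberSum φ (fun v => ‖w v‖ₑ ^ 2) u * ‖f u‖ₑ ^ 2 := by
  rw [enorm_sq_eq_tsum_enorm_sq, ← tsum_mul_comp_eq_tsum_fiberSum_mul φ _ fun u => ‖f u‖ₑ ^ 2]
  refine tsum_congr fun v => ?_
  rw [h f v, enorm_mul, mul_pow]

theorem IsWeightedComposition.fiberSum_ne_top (h : IsWeightedComposition φ w S) (u : V) :
    fiberSum φ (fun v => ‖w v‖ₑ ^ 2) u ≠ ∞ := by
  classical
  have h1 := h.enorm_apply_sq (lp.single 2 u 1)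
  rw [tsum_eq_single u] at h1
  · simp only [lp.single_apply_self, enorm_one, one_pow, mul_one] at h1
    rw [← h1]
    exact ENNReal.pow_ne_top enorm_ne_top
  · intro v hv
    simp [hv]

theorem two_mul_mul_le_add_div {d w g h : ℝ≥0∞} (hd : d ≠ ∞) (hw : w ≠ ∞) (hg : g ≠ ∞) (hh : h ≠ ∞)
    (hdw : d = 0 → w = 0) : 2 * (g * (w * h)) ≤ d * g ^ 2 + w ^ 2 / d * h ^ 2 := by
  rcases eq_or_ne d 0 with rfl | hd0
  · simp [hdw rfl]
  lift d to NNReal using hd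
  lift w to NNReal using hw
  lift g to NNReal using hg
  lift h to NNReal using hh
  have hd0' : d ≠ 0 := by exact_mod_cast hd0
  have hd1 : (0 : ℝ) < d := by positivity
  norm_cast
  rw [← NNReal.coe_le_coe]
  push_cast
  have key : (d : ℝ) * g ^ 2 + w ^ 2 / d * h ^ 2 - 2 * (g * (w * h)) = (d * g - w * h) ^ 2 / d := by
    field_simp
    ring
  have : (0 : ℝ) ≤ (d * g - w * h) ^ 2 / d := by positivity
  linarith

/-- Whenever the sums of `‖w v‖² / ‖S e_v‖²` over the fibres of `φ` are at most `1`, the operator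
is hyponormal. Division in `ℝ≥0∞` takes care of the zero weights: `0 / 0 = 0`, and `c / 0 = ∞` for
`c ≠ 0`. -/
theorem IsWeightedComposition.isHyponormal (h : IsWeightedComposition φ w S)
    (hw : ∀ u, fiberSum φ (fun v => ‖w v‖ₑ ^ 2 / fiberSum φ (fun x => ‖w x‖ₑ ^ 2) v) u ≤ 1) :
    IsHyponormal S := by
  rw [isHyponormal_iff_norm_adjoint_apply_le]
  intro g
  set k := adjoint S g with hk
  set D := fiberSum φ (fun x => ‖w x‖ₑ ^ 2) with hD
  have h1 : ‖k‖ₑ ^ 2 = ‖(inner ℂ g (S k) : ℂ)‖ₑ := by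
    rw [← adjoint_inner_left, ← hk, inner_self_eq_norm_sq_to_K, ← ofReal_norm,
      ← ofReal_norm, ← ENNReal.ofReal_pow (norm_nonneg _)]
    simp
  have h2 : ‖(inner ℂ g (S k) : ℂ)‖ₑ ≤ ∑' v, ‖g v‖ₑ * (‖w v‖ₑ * ‖k (φ v)‖ₑ) := by
    rw [lp.inner_eq_tsum]
    refine enorm_tsum_le_tsum_enorm.trans_eq (tsum_congr fun v => ?_)
    rw [h k v]
    simp only [RCLike.inner_apply, enorm_mul, RCLike.enorm_conj]
    ring
  have hzero : ∀ v, D v = 0 → ‖w v‖ₑ = 0 := by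
    intro v hv
    by_contra hne
    have h3 := (le_fiberSum φ (fun v => ‖w v‖ₑ ^ 2 / D v) v).trans (hw _)
    simp [hv, ENNReal.div_zero, hne] at h3
  -- Applying `2ab ≤ a² + b²` to each summand of `‖S* g‖² = ⟪g, S (S* g)⟫` gives
  -- `2 ‖S* g‖² ≤ ‖S g‖² + ‖S* g‖²`.
  have h3 : 2 * ‖k‖ₑ ^ 2 ≤ ‖S g‖ₑ ^ 2 + ‖k‖ₑ ^ 2 := by
    calc 2 * ‖k‖ₑ ^ 2 ≤ 2 * ∑' v, ‖g v‖ₑ * (‖w v‖ₑ * ‖k (φ v)‖ₑ) := by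
          rw [h1]; gcongr
      _ = ∑' v, 2 * (‖g v‖ₑ * (‖w v‖ₑ * ‖k (φ v)‖ₑ)) := ENNReal.tsum_mul_left.symm
      _ ≤ ∑' v, (D v * ‖g v‖ₑ ^ 2 + ‖w v‖ₑ ^ 2 / D v * ‖k (φ v)‖ₑ ^ 2) :=
          ENNReal.tsum_le_tsum fun v =>
            two_mul_mul_le_add_div (h.fiberSum_ne_top v) enorm_ne_top enorm_ne_top enorm_ne_top
              (hzero v)
      _ = ‖S g‖ₑ ^ 2 + ∑' u, fiberSum φ (fun v => ‖w v‖ₑ ^ 2 / D v) u * ‖k u‖ₑ ^ 2 := by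
          rw [ENNReal.tsum_add, ← h.enorm_apply_sq,
            tsum_mul_comp_eq_tsum_fiberSum_mul φ _ fun u => ‖k u‖ₑ ^ 2]
      _ ≤ ‖S g‖ₑ ^ 2 + ∑' u, 1 * ‖k u‖ₑ ^ 2 := by
          gcongr with u
          exact hw u
      _ = ‖S g‖ₑ ^ 2 + ‖k‖ₑ ^ 2 := by simp [enorm_sq_eq_tsum_enorm_sq k]
  rw [two_mul] at h3
  have h4 : ‖k‖ₑ ^ 2 ≤ ‖S g‖ₑ ^ 2 :=
    ENNReal.le_of_add_le_add_right (ENNReal.pow_ne_top enorm_ne_top) h3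
  have h5 : ‖k‖ₑ ≤ ‖S g‖ₑ := (ENNReal.pow_le_pow_left_iff two_ne_zero).1 h4
  exact enorm_le_iff_norm_le.1 h5

/-- The converse of `IsWeightedComposition.isHyponormal`, tested on finite combinations
`∑ (w v / ‖S e_v‖²) e_v` over a fibre of `φ`. -/
theorem IsWeightedComposition.fiberSum_div_le_one (h : IsWeightedComposition φ w S)
    (hS : IsHyponormal S) (u : V) :
    fiberSum φ (fun v => ‖w v‖ₑ ^ 2 / fiberSum φ (fun x => ‖w x‖ₑ ^ 2) v) u ≤ 1 := by
  classical
  rw [isHyponormal_iff_norm_adjoint_apply_le] at hS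
  set D := fiberSum φ (fun x => ‖w x‖ₑ ^ 2) with hD
  -- The bound `|⟪g, S e_u⟫| = |⟪S* g, e_u⟫| ≤ ‖S* g‖ ≤ ‖S g‖`, for `g` supported on a finite set.
  have key : ∀ (u : V) (s : Finset V) (c : V → ℂ), (∀ v ∈ s, φ v = u) →
      ‖∑ v ∈ s, (starRingEnd ℂ) (c v) * w v‖ₑ ^ 2 ≤ ∑ v ∈ s, D v * ‖c v‖ₑ ^ 2 := by
    intro u s c hs
    set g : lp (fun _ : V => ℂ) 2 := ∑ v ∈ s, lp.single 2 v (c v) with hg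
    have hgv : ∀ v, g v = if v ∈ s then c v else 0 := by
      intro v
      rw [hg, lp.coeFn_sum]
      simp only [lp.coeFn_single, Finset.sum_apply, Finset.sum_pi_single]
    have h1 : inner ℂ g (S (lp.single 2 u 1)) = ∑ v ∈ s, (starRingEnd ℂ) (c v) * w v := by
      rw [hg, sum_inner]
      refine Finset.sum_congr rfl fun v hv => ?_
      rw [lp.inner_single_left, h, hs v hv, lp.single_apply_self]
      simp [mul_comm]
    have h2 : ‖S g‖ₑ ^ 2 = ∑ v ∈ s, D v * ‖c v‖ₑ ^ 2 := by
      rw [h.enorm_apply_sq, tsum_eq_sum (s := s)]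
      · exact Finset.sum_congr rfl fun v hv => by rw [hgv, if_pos hv]
      · intro v hv
        simp [hgv, hv]
    rw [← h1, ← h2, ← adjoint_inner_left]
    gcongr
    rw [enorm_le_iff_norm_le]
    refine (norm_inner_le_norm _ _).trans ?_
    rw [lp.norm_single (by norm_num), norm_one, mul_one]
    exact hS g
  have hzero : ∀ v, D v = 0 → ‖w v‖ₑ = 0 := by
    intro v hv
    have h1 := key (φ v) {v} (fun _ => 1) (by simp)
    simpa [hv] using h1
  have htop : ∀ v, ‖w v‖ₑ ^ 2 / D v ≠ ∞ := by
    intro v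
    by_cases hv : D v = 0
    · simp [hzero v hv]
    · exact ENNReal.div_ne_top (ENNReal.pow_ne_top enorm_ne_top) hv
  rw [fiberSum, ENNReal.tsum_eq_iSup_sum]
  refine iSup_le fun s => ?_
  rw [← Finset.sum_filter]
  set t := s.filter fun v => φ v = u with ht
  set A := ∑ v ∈ t, ‖w v‖ₑ ^ 2 / D v with hA
  have hAtop : A ≠ ∞ := ENNReal.sum_ne_top.2 fun v _ => htop v
  have h1 := key u t (fun v => w v / ((D v).toReal : ℂ)) (fun v hv => (Finset.mem_filter.1 hv).2)
  have hDr : ∀ v, ‖((D v).toReal : ℂ)‖ₑ = D v := by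
    intro v
    rw [← ofReal_norm]
    simpa using h.fiberSum_ne_top v
  have h2 : ∑ v ∈ t, D v * ‖w v / ((D v).toReal : ℂ)‖ₑ ^ 2 = A := by
    refine Finset.sum_congr rfl fun v _ => ?_
    by_cases hv : D v = 0
    · simp [hv, hzero v hv]
    · have hv' : D v ≠ ∞ := h.fiberSum_ne_top v
      have hne : ((D v).toReal : ℂ) ≠ 0 := by simp [ENNReal.toReal_eq_zero_iff, hv, hv']
      rw [div_eq_mul_inv, enorm_mul, enorm_inv hne, hDr, mul_pow, div_eq_mul_inv, sq (D v)⁻¹,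
        mul_left_comm, ← mul_assoc (D v), ENNReal.mul_inv_cancel hv hv', one_mul]
  have h3 : ∑ v ∈ t, (starRingEnd ℂ) (w v / ((D v).toReal : ℂ)) * w v = (A.toReal : ℂ) := by
    rw [hA, ENNReal.toReal_sum fun v _ => htop v, Complex.ofReal_sum]
    refine Finset.sum_congr rfl fun v _ => ?_
    rw [map_div₀, Complex.conj_ofReal, ENNReal.toReal_div, ENNReal.toReal_pow, toReal_enorm,
      div_mul_eq_mul_div, Complex.conj_mul']
    push_cast
    rfl
  have h4 : ‖(A.toReal : ℂ)‖ₑ = A := by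
    rw [← ofReal_norm]
    simp [ENNReal.ofReal_toReal hAtop]
  rw [h2, h3, h4] at h1
  by_contra! hlt
  have : A * 1 < A * A := (ENNReal.mul_lt_mul_iff_right (by positivity) hAtop).2 hlt
  rw [mul_one, ← sq] at this
  exact absurd h1 this.not_ge

/-- Weights whose squared moduli have uniformly bounded sums over the fibres of `φ` define a
bounded weighted composition operator. -/
theorem exists_isWeightedComposition (φ : V → V) (w : V → ℂ) (C : NNReal)
    (hC : ∀ u, fiberSum φ (fun v => ‖w v‖ₑ ^ 2) u ≤ C ^ 2) :
    ∃ S, IsWeightedComposition φ w S := by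
  have hle : ∀ f : lp (fun _ : V => ℂ) 2,
      ∑' v, ‖w v * f (φ v)‖ₑ ^ 2 ≤ (C * ‖f‖ₑ) ^ 2 := by
    intro f
    calc ∑' v, ‖w v * f (φ v)‖ₑ ^ 2 = ∑' v, ‖w v‖ₑ ^ 2 * ‖f (φ v)‖ₑ ^ 2 := by
          simp only [enorm_mul, mul_pow]
      _ = ∑' u, fiberSum φ (fun v => ‖w v‖ₑ ^ 2) u * ‖f u‖ₑ ^ 2 :=
          tsum_mul_comp_eq_tsum_fiberSum_mul φ _ fun u => ‖f u‖ₑ ^ 2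
      _ ≤ ∑' u, C ^ 2 * ‖f u‖ₑ ^ 2 := by
          gcongr with u
          exact hC u
      _ = (C * ‖f‖ₑ) ^ 2 := by
          rw [ENNReal.tsum_mul_left, ← enorm_sq_eq_tsum_enorm_sq, mul_pow]
  have hmem : ∀ f : lp (fun _ : V => ℂ) 2, Memℓp (fun v => w v * f (φ v)) 2 := fun f =>
    memℓp_two_of_tsum_enorm_sq_ne_top <| ne_top_of_le_ne_top
      (ENNReal.pow_ne_top (ENNReal.mul_ne_top ENNReal.coe_ne_top enorm_ne_top)) (hle f)
  let L : lp (fun _ : V => ℂ) 2 →ₗ[ℂ] lp (fun _ : V => ℂ) 2 :=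
    { toFun := fun f => ⟨fun v => w v * f (φ v), hmem f⟩
      map_add' := fun f g => lp.ext <| funext fun v => mul_add (w v) (f (φ v)) (g (φ v))
      map_smul' := fun c f => lp.ext <| funext fun v => mul_left_comm (w v) c (f (φ v)) }
  refine ⟨L.mkContinuous C fun f => ?_, fun f v => rfl⟩
  have h1 : ‖L f‖ₑ ≤ C * ‖f‖ₑ := by
    rw [← ENNReal.pow_le_pow_left_iff two_ne_zero, enorm_sq_eq_tsum_enorm_sq]
    exact hle f
  rw [enorm_eq_nnnorm, enorm_eq_nnnorm, ← ENNReal.coe_mul, ENNReal.coe_le_coe] at h1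
  exact_mod_cast h1

end Hyponormal

/-! ### Powers of a weighted composition operator -/

section Powers

variable {V : Type*}

/-- The product `F v * F (p v) * ⋯` of `F` along the first `n` points of the `p`-orbit of `v`. -/
def iterProd {M : Type*} [CommMonoid M] (p : V → V) (F : V → M) : ℕ → V → M
  | 0, _ => 1
  | n + 1, v => F v * iterProd p F n (p v)

theorem iterProd_succ' {M : Type*} [CommMonoid M] (p : V → V) (F : V → M) (n : ℕ) (v : V) :
    iterProd p F (n + 1) v = iterProd p F n v * F (p^[n] v) := by
  induction n generalizing v with
  | zero => simp [iterProd]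
  | succ n ih =>
    rw [iterProd, ih (p v), iterProd, mul_assoc, Function.iterate_succ_apply]

theorem enorm_iterProd_sq (p : V → V) (w : V → ℂ) (n : ℕ) (v : V) :
    ‖iterProd p w n v‖ₑ ^ 2 = iterProd p (fun v => ‖w v‖ₑ ^ 2) n v := by
  induction n generalizing v with
  | zero => simp [iterProd]
  | succ n ih => rw [iterProd, iterProd, enorm_mul, mul_pow, ih]

theorem IsWeightedComposition.pow {p : V → V} {w : V → ℂ}
    {S : lp (fun _ : V => ℂ) 2 →L[ℂ] lp (fun _ : V => ℂ) 2} (h : IsWeightedComposition p w S)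
    (n : ℕ) : IsWeightedComposition p^[n] (iterProd p w n) (S ^ n) := by
  induction n with
  | zero => intro f v; simp [iterProd]
  | succ n ih =>
    rw [pow_succ']
    exact h.mul ih

theorem fiberSum_comp (p q : V → V) (F G : V → ℝ≥0∞) (u : V) :
    fiberSum (p ∘ q) (fun x => F x * G (q x)) u = fiberSum p (fun y => G y * fiberSum q F y) u := by
  classical
  have h := tsum_mul_comp_eq_tsum_fiberSum_mul q F fun y => if p y = u then G y else 0
  simp only [mul_ite, mul_zero] at h
  simpa only [fiberSum, Function.comp_apply, mul_comm] using h

theorem fiberSum_iterate_zero (p : V → V) (F : V → ℝ≥0∞) (u : V) :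
    fiberSum p^[0] (iterProd p F 0) u = 1 :=
  fiberSum_eq_single (v := u) rfl fun _ hx hne => absurd hx hne

/-- The fibre sums of the iterated weights satisfy a recursion over the children of a vertex. -/
theorem fiberSum_iterate_succ (p : V → V) (F : V → ℝ≥0∞) (n : ℕ) (u : V) :
    fiberSum p^[n + 1] (iterProd p F (n + 1)) u
      = fiberSum p (fun y => F y * fiberSum p^[n] (iterProd p F n) y) u := by
  rw [← fiberSum_comp, ← Function.iterate_succ']
  congr 1
  ext v
  exact iterProd_succ' p F n v

section Unbranched

variable {p : V → V} {W : V → ℝ≥0∞}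

/-- In particular, a vertex of nonzero weight has a child of nonzero weight. -/
theorem le_fiberSum_of_fiberSum_div_le_one
    (hW : ∀ u, fiberSum p (fun v => W v / fiberSum p W v) u ≤ 1) (v : V) :
    W v ≤ fiberSum p W v := by
  have h := (le_fiberSum p (fun v => W v / fiberSum p W v) v).trans (hW _)
  rcases eq_or_ne (fiberSum p W v) 0 with h0 | h0
  · by_contra hne
    rw [h0] at h hne
    rw [ENNReal.div_zero fun h' => hne h'.le] at h
    simp at h
  · rcases eq_or_ne (fiberSum p W v) ∞ with h1 | h1
    · simp [h1]
    · simpa using (ENNReal.div_le_iff h0 h1).1 h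

/-- Unless a vertex carrying a nonzero weight has several children carrying nonzero weights, the
hyponormality criterion passes from `p` to its iterates: `p` maps the support of the iterated
weights injectively, and by monotonicity of the weights along the unbranched lines, each summand
for `p^[n + 2]` at `v` is at most the summand for `p^[n + 1]` at `p v`. -/
theorem fiberSum_iterate_div_le_one (hfin : ∀ v, W v ≠ ∞)
    (hW : ∀ u, fiberSum p (fun v => W v / fiberSum p W v) u ≤ 1)
    (hinj : ∀ x y, W x ≠ 0 → W y ≠ 0 → W (p x) ≠ 0 → p x = p y → x = y) (n : ℕ) (u : V) :
    fiberSum p^[n + 1] (fun v => iterProd p W (n + 1) v /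
      fiberSum p^[n + 1] (iterProd p W (n + 1)) v) u ≤ 1 := by
  set D : ℕ → V → ℝ≥0∞ := fun n => fiberSum p^[n] (iterProd p W n) with hD
  have hchild : ∀ v, W v ≠ 0 → ∃ x, p x = v ∧ W x ≠ 0 := fun v hv =>
    exists_ne_zero_of_fiberSum_ne_zero (F := W) fun h0 =>
      hv (le_zero_iff.1 (h0 ▸ le_fiberSum_of_fiberSum_div_le_one hW v))
  -- By `hinj`, the sum for `D (n + 1)` over the children of a vertex of nonzero weight has a single
  -- nonzero summand.
  have hsucc : ∀ n x, W x ≠ 0 → W (p x) ≠ 0 → D (n + 1) (p x) = W x * D n x := by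
    intro n x hx hpx
    refine (fiberSum_iterate_succ p W n (p x)).trans (fiberSum_eq_single rfl fun y hy hne => ?_)
    by_contra h0
    exact hne (hinj x y hx (left_ne_zero_of_mul h0) hpx hy.symm).symm
  have hWmono : ∀ x, W x ≠ 0 → W (p x) ≠ 0 → W (p x) ≤ W x := by
    intro x hx hpx
    refine (le_fiberSum_of_fiberSum_div_le_one hW (p x)).trans_eq
      (fiberSum_eq_single rfl fun y hy hne => ?_)
    by_contra h0
    exact hne (hinj x y hx h0 hpx hy.symm).symm
  have hDmono : ∀ n x, W x ≠ 0 → W (p x) ≠ 0 → D n (p x) ≤ D n x := by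
    intro n
    induction n with
    | zero => intro x _ _; simp only [hD, fiberSum_iterate_zero]; exact le_rfl
    | succ n ih =>
      intro x hx hpx
      obtain ⟨y, rfl, hy⟩ := hchild x hx
      rw [hsucc n _ hx hpx, hsucc n y hy hx]
      gcongr
      · exact hWmono y hy hx
      · exact ih y hy hx
  have hDsucc : ∀ n v, W v ≠ 0 → W v * D n v ≤ D (n + 1) v := by
    intro n v hv
    obtain ⟨x, rfl, hx⟩ := hchild v hv
    rw [hsucc n x hx hv]
    gcongr
    · exact hWmono x hx hv
    · exact hDmono n x hx hv
  have hne : ∀ n v, iterProd p W (n + 2) v / D (n + 2) v ≠ 0 → W v ≠ 0 ∧ W (p v) ≠ 0 := by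
    intro n v hv
    have h1 : W v * (W (p v) * iterProd p W n (p (p v))) ≠ 0 :=
      fun h0 => hv (ENNReal.div_eq_zero_iff.2 (Or.inl h0))
    exact ⟨left_ne_zero_of_mul h1, left_ne_zero_of_mul (right_ne_zero_of_mul h1)⟩
  change fiberSum p^[n + 1] (fun v => iterProd p W (n + 1) v / D (n + 1) v) u ≤ 1
  induction n with
  | zero =>
    have h1 : D 1 = fiberSum p W := by
      ext v
      simp only [hD, fiberSum_iterate_succ, fiberSum_iterate_zero, mul_one]
    simpa [iterProd, h1] using hW u
  | succ n ih =>
    refine (fiberSum_le_fiberSum_of_injOn p u ?_ (fun v hv _ => hv) ?_).trans ih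
    · intro x hx y hy hxy
      exact hinj x y (hne n x hx.2).1 (hne n y hy.2).1 (hne n x hx.2).2 hxy
    · intro v _ hv
      obtain ⟨h1, h2⟩ := hne n v hv
      have h3 : W v * D (n + 1) (p v) ≤ D (n + 2) v := by
        rw [hsucc n v h1 h2]
        exact (mul_le_mul_right (hDsucc n v h1) _).trans (hDsucc (n + 1) v h1)
      calc iterProd p W (n + 2) v / D (n + 2) v
          ≤ W v * iterProd p W (n + 1) (p v) / (W v * D (n + 1) (p v)) := by
            exact ENNReal.div_le_div_left h3 _
        _ = iterProd p W (n + 1) (p v) / D (n + 1) (p v) :=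
            ENNReal.mul_div_mul_left _ _ h1 (hfin v)

end Unbranched

end Powers

/-! ### Leafless and forkless forests -/

namespace DirectedForest

section Forests

variable {V : Type*}

/-- A leafless forest is forkless exactly when its parent function is injective away from the
children of the roots. -/
theorem Leafless.forkless_iff {R : DirectedForest V} (hR : R.Leafless) :
    R.Forkless ↔ ∀ x y, ¬ R.IsRoot (R.parent x) → R.parent x = R.parent y → x = y := by
  have hne : ∀ x, ¬ R.IsRoot (R.parent x) → R.parent x ≠ x := fun x hx h =>
    hx (congrArg R.parent h)
  constructor
  · intro h x y hx hxy
    have h1 := h _ hx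
    rw [degree, Cardinal.eq_one_iff_unique] at h1
    have hy : R.parent x ≠ y := by
      rw [hxy] at hx ⊢
      exact hne y hx
    exact congrArg Subtype.val
      (h1.1.elim (⟨x, rfl, hne x hx⟩ : R.children (R.parent x)) ⟨y, hxy.symm, hy⟩)
  · intro h v hv
    obtain ⟨x, rfl⟩ := hR v
    rw [degree, Cardinal.eq_one_iff_unique]
    refine ⟨⟨fun y z => Subtype.ext ?_⟩, ⟨⟨x, rfl, hne x hv⟩⟩⟩
    exact (h x y hv y.2.1.symm).symm.trans (h x z hv z.2.1.symm)

theorem Forkless.of_thinner {R S : DirectedForest V} (hS : S.Forkless) (hSl : S.Leafless)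
    (hR : R.Leafless) (hRS : R.Thinner S) : R.Forkless := by
  rw [hR.forkless_iff]
  rw [hSl.forkless_iff] at hS
  have key : ∀ v, ¬ R.IsRoot v → R.parent v = S.parent v := fun v hv => (hRS v).resolve_left hv
  have hroot : ∀ v, ¬ R.IsRoot (R.parent v) → ¬ R.IsRoot v := fun v hv h =>
    hv (congrArg R.parent h)
  intro x y hx hxy
  have h1 := key x (hroot x hx)
  have h2 := key y (hroot y (hxy ▸ hx))
  refine hS x y ?_ (h1.symm.trans (hxy.trans h2))
  intro h
  rw [← h1] at h
  exact hx ((key _ hx).trans h)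

open Classical in
/-- The forest in which every vertex of zero weight is turned into a root. -/
noncomputable def weightSupport (T : DirectedForest V) (w : V → ℂ) : DirectedForest V where
  parent v := if w v = 0 then v else T.parent v
  acyclic := T.acyclic_of_thinner _ fun _ => ite_eq_or_eq _ _ _

theorem weightSupport_thinner (T : DirectedForest V) (w : V → ℂ) :
    (T.weightSupport w).Thinner T := fun _ => ite_eq_or_eq _ _ _

theorem weightSupport_parent {T : DirectedForest V} {w : V → ℂ} {v : V} (hv : w v ≠ 0) :
    (T.weightSupport w).parent v = T.parent v := if_neg hv

theorem weightSupport_leafless {T : DirectedForest V} {w : V → ℂ}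
    (h : ∀ v, w v ≠ 0 → ∃ x, T.parent x = v ∧ w x ≠ 0) : (T.weightSupport w).Leafless := by
  intro v
  by_cases hv : w v = 0
  · exact ⟨v, if_pos hv⟩
  · obtain ⟨x, hx, hwx⟩ := h v hv
    exact ⟨x, (weightSupport_parent hwx).trans hx⟩

theorem isBoundedWeightedShift_iff {T : DirectedForest V}
    {S : lp (fun _ : V => ℂ) 2 →L[ℂ] lp (fun _ : V => ℂ) 2} :
    T.IsBoundedWeightedShift S ↔
      ∃ w, T.IsWeightSystem w ∧ IsWeightedComposition T.parent w S :=
  exists_congr fun _ => and_congr_right fun _ => forall_congr' fun _ => funext_iff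

/-- The weights of a hyponormal weighted shift are supported on a leafless forest; if that forest
is forkless, all powers of the shift are hyponormal. -/
theorem isPowerHyponormal_of_forall_forkless {T : DirectedForest V}
    (hT : ∀ R : DirectedForest V, R.Leafless → R.Thinner T → R.Forkless)
    {S : lp (fun _ : V => ℂ) 2 →L[ℂ] lp (fun _ : V => ℂ) 2}
    (hS : T.IsBoundedWeightedShift S) (hyp : IsHyponormal S) : IsPowerHyponormal S := by
  obtain ⟨w, hw, hSw⟩ := isBoundedWeightedShift_iff.1 hS
  have hle := hSw.fiberSum_div_le_one hyp
  have hW : ∀ v, ‖w v‖ₑ ^ 2 ≠ 0 ↔ w v ≠ 0 := fun v => by simp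
  have hleafless : (T.weightSupport w).Leafless := by
    refine weightSupport_leafless fun v hv => ?_
    simp only [← hW] at hv ⊢
    exact exists_ne_zero_of_fiberSum_ne_zero (F := fun v => ‖w v‖ₑ ^ 2) fun h0 =>
      hv (le_zero_iff.1 (h0 ▸ le_fiberSum_of_fiberSum_div_le_one hle v))
  have hforkless := hleafless.forkless_iff.1 (hT _ hleafless (T.weightSupport_thinner w))
  intro n hn
  obtain ⟨n, rfl⟩ := Nat.exists_eq_add_of_le' hn
  refine (hSw.pow (n + 1)).isHyponormal fun u => ?_
  simp only [enorm_iterProd_sq]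
  refine fiberSum_iterate_div_le_one (fun v => ENNReal.pow_ne_top enorm_ne_top) hle ?_ n u
  intro x y hx hy hpx hxy
  rw [hW] at hx hy hpx
  refine hforkless x y ?_ ?_
  · rw [weightSupport_parent hx, IsRoot, weightSupport_parent hpx]
    exact fun h => hpx (hw _ h)
  · rw [weightSupport_parent hx, weightSupport_parent hy, hxy]

end Forests

end DirectedForest

/-! ### A hyponormal shift at a fork whose square is not hyponormal -/

namespace DirectedForest

section Fork

variable {V : Type*}

/-- A fork: a vertex which is not a root, with two disjoint infinite lines of descendants starting
at distinct children of it. The branching vertex is `node none`, and `node (some (i, n))` is the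
vertex number `n` of the line `i`. -/
structure Fork (R : DirectedForest V) where
  /-- the vertices of the fork -/
  node : Option (Bool × ℕ) → V
  injective : Function.Injective node
  parent_head (i : Bool) : R.parent (node (some (i, 0))) = node none
  parent_line (i : Bool) (n : ℕ) : R.parent (node (some (i, n + 1))) = node (some (i, n))
  parent_ne (j : Option (Bool × ℕ)) : R.parent (node none) ≠ node j

theorem Leafless.exists_fork {R : DirectedForest V} (hR : R.Leafless) (hf : ¬ R.Forkless) :
    Nonempty R.Fork := by
  rw [hR.forkless_iff] at hf
  push Not at hf
  obtain ⟨a, b, hroot, hab, hne⟩ := hf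
  set o := R.parent a with ho
  obtain ⟨c, hc⟩ := hR.hasRightInverse
  -- The lines follow a section `c` of the parent function; that their vertices are distinct
  -- follows from acyclicity, since `R.parent^[n + 1]` maps vertex number `n` of a line to `o`.
  have hcycle : ∀ n, R.parent^[n + 1] o ≠ o := fun n h =>
    hroot (R.acyclic (n + 1) o (by omega) h)
  let head : Bool → V := fun i => if i then b else a
  have hhead : ∀ i, R.parent (head i) = o := by
    rintro (_ | _)
    · rfl
    · exact hab.symm
  have hinj : Function.Injective head := by
    rintro (_ | _) (_ | _) h
    · rfl
    · exact absurd h hne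
    · exact absurd h.symm hne
    · rfl
  have hline : ∀ i n, R.parent^[n] (c^[n] (head i)) = head i := fun i n =>
    Function.LeftInverse.iterate hc n (head i)
  have hup : ∀ i n, R.parent^[n + 1] (c^[n] (head i)) = o := fun i n => by
    rw [Function.iterate_succ_apply', hline, hhead]
  have hlt : ∀ i j n m, n < m → c^[n] (head i) ≠ c^[m] (head j) := by
    intro i j n m hnm h
    obtain ⟨k, rfl⟩ := Nat.exists_eq_add_of_lt hnm
    have h1 := hup j (n + k + 1)
    rw [← h, show n + k + 1 + 1 = (k + 1) + (n + 1) by ring, Function.iterate_add_apply, hup] at h1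
    exact hcycle k h1
  have ho_ne : ∀ i n, o ≠ c^[n] (head i) := fun i n h => hcycle n <| by
    have h1 := hup i n
    rwa [← h] at h1
  let node : Option (Bool × ℕ) → V
    | none => o
    | some (i, n) => c^[n] (head i)
  refine ⟨⟨node, ?_, hhead, ?_, ?_⟩⟩
  · rintro (_ | ⟨i, n⟩) (_ | ⟨j, m⟩) h
    · rfl
    · exact absurd h (ho_ne j m)
    · exact absurd h.symm (ho_ne i n)
    · rcases lt_trichotomy n m with hnm | rfl | hnm
      · exact absurd h (hlt i j n m hnm)
      · have h1 : R.parent^[n] (c^[n] (head i)) = R.parent^[n] (c^[n] (head j)) :=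
          congrArg _ h
        rw [hline, hline] at h1
        rw [hinj h1]
      · exact absurd h.symm (hlt j i m n hnm)
  · intro i n
    change R.parent (c^[n + 1] (head i)) = c^[n] (head i)
    rw [Function.iterate_succ_apply', hc]
  · rintro (_ | ⟨i, n⟩) h
    · exact hroot h
    · have h1 : R.parent^[n + 1] (R.parent o) = o := by
        rw [show R.parent o = c^[n] (head i) from h, hup]
      exact hcycle (n + 1) h1

namespace Fork

variable {R : DirectedForest V} (K : R.Fork)

theorem parent_ne_self (j : Option (Bool × ℕ)) : R.parent (K.node j) ≠ K.node j := by
  rcases j with _ | ⟨i, _ | n⟩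
  · exact K.parent_ne none
  · rw [K.parent_head]
    exact K.injective.ne (by simp)
  · rw [K.parent_line]
    exact K.injective.ne (by simp)

variable {F : V → ℝ≥0∞}

theorem fiberSum_parent_none (hF : ∀ v, v ∉ Set.range K.node → F v = 0) :
    fiberSum R.parent F (R.parent (K.node none)) = F (K.node none) := by
  refine fiberSum_eq_single rfl fun x hx hne => hF x ?_
  rintro ⟨_ | ⟨i, _ | n⟩, rfl⟩
  · exact hne rfl
  · exact K.parent_ne _ (hx.symm.trans (K.parent_head i))
  · exact K.parent_ne _ (hx.symm.trans (K.parent_line i n))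

theorem fiberSum_none (hF : ∀ v, v ∉ Set.range K.node → F v = 0) :
    fiberSum R.parent F (K.node none)
      = F (K.node (some (false, 0))) + F (K.node (some (true, 0))) := by
  classical
  have hne : K.node (some (false, 0)) ≠ K.node (some (true, 0)) := K.injective.ne (by simp)
  rw [← Finset.sum_pair hne]
  refine fiberSum_eq_sum _ (by simp [K.parent_head]) fun x hx hnot => hF x ?_
  rintro ⟨_ | ⟨i, _ | n⟩, rfl⟩
  · exact K.parent_ne _ hx
  · cases i <;> simp at hnot
  · rw [K.parent_line] at hx
    simpa using K.injective hx

theorem fiberSum_some (hF : ∀ v, v ∉ Set.range K.node → F v = 0) (i : Bool) (n : ℕ) :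
    fiberSum R.parent F (K.node (some (i, n))) = F (K.node (some (i, n + 1))) := by
  refine fiberSum_eq_single (K.parent_line i n) fun x hx hne => hF x ?_
  rintro ⟨_ | ⟨j, _ | m⟩, rfl⟩
  · exact K.parent_ne _ hx
  · rw [K.parent_head] at hx
    simpa using K.injective hx
  · rw [K.parent_line] at hx
    have h := K.injective hx
    simp only [Option.some.injEq, Prod.mk.injEq] at h
    exact hne (by rw [h.1, h.2])

theorem fiberSum_of_notMem (hF : ∀ v, v ∉ Set.range K.node → F v = 0) {u : V}
    (hu : u ∉ Set.range K.node) (hu' : u ≠ R.parent (K.node none)) :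
    fiberSum R.parent F u = 0 := by
  refine fiberSum_eq_zero fun x hx => hF x ?_
  rintro ⟨_ | ⟨i, _ | n⟩, rfl⟩
  · exact hu' hx.symm
  · exact hu ⟨_, (K.parent_head i).symm.trans hx⟩
  · exact hu ⟨_, (K.parent_line i n).symm.trans hx⟩

/-- The nonzero weights of the shift: `8` at the branching vertex, `3, 5, 5, …` and `8, 10, 10, …`
along the two lines. -/
def label : Option (Bool × ℕ) → ℕ
  | none => 8
  | some (false, 0) => 3
  | some (true, 0) => 8
  | some (false, _ + 1) => 5
  | some (true, _ + 1) => 10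

/-- The weights `label` on the fork, extended by zero. -/
noncomputable def weight : V → ℂ := Function.extend K.node (fun j => (label j : ℂ)) 0

theorem weight_node (j : Option (Bool × ℕ)) : K.weight (K.node j) = label j :=
  K.injective.extend_apply _ _ _

theorem weight_of_notMem {v : V} (hv : v ∉ Set.range K.node) : K.weight v = 0 :=
  Function.extend_apply' _ _ _ hv

theorem enorm_weight_node_sq (j : Option (Bool × ℕ)) :
    ‖K.weight (K.node j)‖ₑ ^ 2 = (label j : ℝ≥0∞) ^ 2 := by
  rw [weight_node, ← ofReal_norm, Complex.norm_natCast, ENNReal.ofReal_natCast]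

theorem enorm_weight_sq_of_notMem (v : V) (hv : v ∉ Set.range K.node) : ‖K.weight v‖ₑ ^ 2 = 0 := by
  simp [K.weight_of_notMem hv]

/-- The criterion for the shift itself holds with equality `3² / 5² + 8² / 10² = 1` at the
branching vertex. -/
theorem fiberSum_weight_div_le_one (u : V) :
    fiberSum R.parent (fun v => ‖K.weight v‖ₑ ^ 2 /
      fiberSum R.parent (fun v => ‖K.weight v‖ₑ ^ 2) v) u ≤ 1 := by
  have hW := K.enorm_weight_sq_of_notMem
  have hQ : ∀ v, v ∉ Set.range K.node → (fun v => ‖K.weight v‖ₑ ^ 2 /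
      fiberSum R.parent (fun v => ‖K.weight v‖ₑ ^ 2) v) v = 0 := fun v hv => by
    simp [K.weight_of_notMem hv]
  by_cases hu : u ∈ Set.range K.node
  · obtain ⟨_ | ⟨i, n⟩, rfl⟩ := hu
    · rw [K.fiberSum_none hQ, K.fiberSum_some hW, K.fiberSum_some hW]
      simp only [enorm_weight_node_sq, label]
      rw [← ENNReal.toReal_le_toReal (by finiteness) (by finiteness),
        ENNReal.toReal_add (by finiteness) (by finiteness)]
      simp
      norm_num
    · rw [K.fiberSum_some hQ, K.fiberSum_some hW]
      simp only [enorm_weight_node_sq]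
      cases i <;> exact ENNReal.div_self_le_one
  · by_cases hu' : u = R.parent (K.node none)
    · rw [hu', K.fiberSum_parent_none hQ, K.fiberSum_none hW]
      simp only [enorm_weight_node_sq, label]
      refine ENNReal.div_le_of_le_mul ?_
      norm_num
    · rw [K.fiberSum_of_notMem hQ hu hu']
      exact zero_le_one

theorem fiberSum_weight_le (u : V) :
    fiberSum R.parent (fun v => ‖K.weight v‖ₑ ^ 2) u ≤ (10 : NNReal) ^ 2 := by
  have hW := K.enorm_weight_sq_of_notMem
  by_cases hu : u ∈ Set.range K.node
  · obtain ⟨_ | ⟨_ | _, n⟩, rfl⟩ := hu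
    · rw [K.fiberSum_none hW]
      simp only [enorm_weight_node_sq, label]
      norm_num
    · rw [K.fiberSum_some hW]
      simp only [enorm_weight_node_sq, label]
      norm_num
    · rw [K.fiberSum_some hW]
      simp only [enorm_weight_node_sq, label]
      norm_num
  · by_cases hu' : u = R.parent (K.node none)
    · rw [hu', K.fiberSum_parent_none hW]
      simp only [enorm_weight_node_sq, label]
      norm_num
    · rw [K.fiberSum_of_notMem hW hu hu']
      exact zero_le

/-- The criterion for the square of the shift fails at the parent of the branching vertex, where
the sum is `8² * (3² / 5⁴ + 8² / 10⁴) > 1`. -/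
theorem one_lt_fiberSum_iterProd_weight :
    1 < fiberSum R.parent^[2] (fun v => ‖iterProd R.parent K.weight 2 v‖ₑ ^ 2 /
      fiberSum R.parent^[2] (fun v => ‖iterProd R.parent K.weight 2 v‖ₑ ^ 2) v)
      (R.parent (K.node none)) := by
  have hW := K.enorm_weight_sq_of_notMem
  simp only [enorm_iterProd_sq]
  set W : V → ℝ≥0∞ := fun v => ‖K.weight v‖ₑ ^ 2 with hWdef
  set D : V → ℝ≥0∞ := fiberSum R.parent^[2] (iterProd R.parent W 2) with hD
  have hWnode : ∀ j, W (K.node j) = (label j : ℝ≥0∞) ^ 2 := K.enorm_weight_node_sq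
  -- Separating the weight at the parent lets the sum over `R.parent^[2]` be taken in two stages.
  have h1 : (fun v => iterProd R.parent W 2 v / D v) = fun v => W v / D v * W (R.parent v) := by
    ext v
    simp only [iterProd, mul_one, div_eq_mul_inv]
    ring
  have hDnode : ∀ i, D (K.node (some (i, 0)))
      = W (K.node (some (i, 1))) * W (K.node (some (i, 2))) := by
    intro i
    rw [hD, fiberSum_iterate_succ, K.fiberSum_some, fiberSum_iterate_succ, K.fiberSum_some]
    · rw [fiberSum_iterate_zero, mul_one]
    all_goals intro v hv; simp [W, K.weight_of_notMem hv]
  rw [h1, show R.parent^[2] = R.parent ∘ R.parent from rfl, fiberSum_comp,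
    K.fiberSum_parent_none, K.fiberSum_none, hDnode, hDnode]
  · simp only [hWnode, label]
    rw [← ENNReal.toReal_lt_toReal (by finiteness) (by finiteness), ENNReal.toReal_mul,
      ENNReal.toReal_add (by finiteness) (by finiteness)]
    simp
    norm_num
  all_goals intro v hv; simp [W, K.weight_of_notMem hv]

end Fork

theorem exists_isHyponormal_not_isHyponormal_sq {T R : DirectedForest V} (hR : R.Leafless)
    (hRT : R.Thinner T) (hf : ¬ R.Forkless) :
    ∃ S, T.IsBoundedWeightedShift S ∧ IsHyponormal S ∧ ¬ IsHyponormal (S ^ 2) := by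
  obtain ⟨K⟩ := hR.exists_fork hf
  obtain ⟨S, hS⟩ := exists_isWeightedComposition R.parent K.weight 10 (by
    simpa using K.fiberSum_weight_le)
  have hparent : ∀ v, K.weight v ≠ 0 → R.parent v = T.parent v ∧ ¬ T.IsRoot v := by
    intro v hv
    have hmem : v ∈ Set.range K.node := by
      by_contra hmem
      exact hv (K.weight_of_notMem hmem)
    obtain ⟨j, rfl⟩ := hmem
    have h := (hRT (K.node j)).resolve_left (K.parent_ne_self j)
    exact ⟨h, fun hroot => K.parent_ne_self j (h.trans hroot)⟩
  refine ⟨S, isBoundedWeightedShift_iff.2 ⟨K.weight, ?_, ?_⟩,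
    hS.isHyponormal K.fiberSum_weight_div_le_one, fun h => ?_⟩
  · intro v hv
    by_contra h
    exact (hparent v h).2 hv
  · intro f v
    rw [hS f v]
    by_cases hv : K.weight v = 0
    · simp [hv]
    · rw [(hparent v hv).1]
  · exact ((hS.pow 2).fiberSum_div_le_one h _).not_gt K.one_lt_fiberSum_iterProd_weight

end Fork

end DirectedForest

/-! ### The equivalence -/

theorem theorem5p3 {V : Type*} [Nonempty V] (T : DirectedForest V) :
    List.TFAE [
      ∀ S : lp (fun _ : V => ℂ) 2 →L[ℂ] lp (fun _ : V => ℂ) 2,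
        T.IsBoundedWeightedShift S → IsHyponormal S → IsPowerHyponormal S,
      ∀ S : lp (fun _ : V => ℂ) 2 →L[ℂ] lp (fun _ : V => ℂ) 2,
        T.IsBoundedWeightedShift S → IsHyponormal S → IsHyponormal (S ^ 2),
      T.leaflessSupport.Forkless,
      ∀ R : DirectedForest V, R.Leafless → R.Thinner T → R.Forkless] := by
  have hsupp := T.isLeaflessSupport_leaflessSupport
  tfae_have 1 → 2 := fun h S hS hyp => h S hS hyp 2 one_le_two
  tfae_have 2 → 4 := by
    intro h R hR hRT
    by_contra hf
    obtain ⟨S, hS, hyp, hsq⟩ := DirectedForest.exists_isHyponormal_not_isHyponormal_sq hR hRT hf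
    exact hsq (h S hS hyp)
  tfae_have 4 → 1 := fun h S hS hyp => DirectedForest.isPowerHyponormal_of_forall_forkless h hS hyp
  tfae_have 4 → 3 := fun h => h _ hsupp.1.1 hsupp.1.2
  tfae_have 3 → 4 := fun h R hR hRT => h.of_thinner hsupp.1.1 hR (hsupp.2 R hR hRT)
  tfae_finish
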